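/- Let $q=2^n>2$, let $F=\mathbb F_{q^m}$, and let $0\ne a\in F$. Put $$f(x)=x^{q+1}+x,\qquad T(x)=\sum_{i=0}^{n-1}x^{2^i-1},\qquad C(x)=x\,T(x)^{q+1}.$$ For $g\in F[x]$ write $g\sim[d_1,\dots,d_t]$ if $g$ factors over $F$ into irreducibles of degrees $d_1,\dots,d_t$ (with multiplicity). (i) If $f(x)+1/a$ has at least three distinct roots in $F$, then $f(x)+1/a$ and $C(x)+a$ both split into linear factors over $F$. (ii) If $f(x)+1/a$ has exactly two distinct roots in $F$, then there is a divisor $\delta$ of $q-1$ such that $f(x)+1/a\sim[1,1,\delta,\dots,\delta]$ and $C(x)+a\sim[\delta,\dots,\delta]$, with $\delta$ occurring $\frac{q-1}{\delta}$ and $\frac q2\cdot\frac{q-1}{\delta}$ times, respectively. (iii) If $f(x)+1/a$ has exactly one root in $F$, then $f(x)+1/a\sim[1,2,\dots,2]$ (with $q/2$ quadratic factors), and $C(x)+a\sim[1,\dots,1,2,\dots,2]$ with exactly $q/2$ linear and $(q^2-2q)/4$ irreducible quadratic factors. (iv) If $f(x)+1/a$ has no root in $F$, then there is a divisor $\delta$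 of $q+1$ such that $f(x)+1/a\sim[\delta,\dots,\delta]$ and $C(x)+a\sim[1,\delta,\dots,\delta]$, with $\delta$ occurring $\frac{q+1}{\delta}$ and $\left(\frac q2-1\right)\frac{q+1}{\delta}$ times, respectively. -/

import Mathlib

open Polynomial

/-- The polynomial `T(x) = ∑_{i=0}^{n-1} x^(2^i - 1)` over `F`. The exponent `2 ^ i - 1` is a
natural-number subtraction, with `2 ^ i ≥ 1`. -/
noncomputable def mcmT (F : Type*) [Field F] (n : ℕ) : F[X] :=
  ∑ i ∈ Finset.range n, X ^ (2 ^ i - 1)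

/-- The Müller--Cohen--Matthews polynomial `C(x) = x * T(x)^(q+1)` with `q = 2 ^ n`. -/
noncomputable def mcmC (F : Type*) [Field F] (n : ℕ) : F[X] :=
  X * mcmT F n ^ (2 ^ n + 1)

/-- `HasFactorType g d` is the relation `g ∼ [d₁, …, d_t]`: up to a unit, `g` is a product of
irreducible polynomials over `F` (listed with multiplicity) whose degrees are the members
of the multiset `d`. -/
def HasFactorType {F : Type*} [Field F] (g : F[X]) (d : Multiset ℕ) : Prop :=
  ∃ s : Multiset F[X], (∀ p ∈ s, Irreducible p) ∧ Associated s.prod g ∧ s.map natDegree = d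

/-! Over the algebraic closure `K` of `F`, let `σ` be the `q`-power map, `B = 1/a`, and `V` the
kernel of `σ² + σ + B`, a plane over the fixed field F_q of `σ`. The map `y ↦ σ y / y` identifies
the points of P(V) with the `q + 1` roots of `x^(q+1) + x + B`. A root `x` of `C + a` is determined
by `s = S x = x T(x)`. For a basis `y₁, y₂` of `V`, these `s` are exactly the values `(α y₁² + y₁ y₂
+ γ y₂²) / moore σ y₁ y₂` with `α, γ` in F_q and `S (α γ) = 1` (`IsMCMRoot.exists_form`,
`isMCMRoot_of_form`). On F_q, `S` is the absolute trace, so the condition says that the form is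
anisotropic.

The order of `F` is a power of `q`, so its Frobenius `φ` acts F_q-linearly on `V`. Fixed roots of
the first polynomial are eigenlines; fixed roots of `C + a` are the anisotropic forms `Q` with `Q ∘
φ = det φ · Q`. Everything then depends on the class of `φ` in PGL₂(q). With three eigenlines, `φ`
is scalar and fixes every root. With two, it has distinct eigenvalues and fixes no anisotropic form.
With one, it is a scalar times a nontrivial unipotent; it fixes `q/2` forms and its square is
scalar. With none, it fixes one form, proportional to the norm form given by its characteristic
polynomial. In the second and fourth cases `δ` is the order of `φ` in PGL₂(q). Both polynomials are
separable, so orbit lengths are factor degrees and the multiplicities follow by counting degrees. -/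

section LinearizedKernel

/-! ### The plane `V`, its Moore determinant and linear maps on it -/

variable {K : Type*} [Field K] {σ : K →+* K} {S : K →+ K} {B : K}
  {ψ : K →+* K}

/-- `y` lies in the kernel of the operator `σ² + σ + B`. -/
def InKernel (σ : K →+* K) (B y : K) : Prop := σ (σ y) = σ y + B * y

/-- The Moore determinant of `y` and `z` with respect to `σ`. -/
def moore (σ : K →+* K) (y z : K) : K := y * σ z + z * σ y

theorem map_div_of_map_eq_mul (hB : B ≠ 0) {d e : K} (hd : σ d = B * d) (he : σ e = B * e) :
    σ (e / d) = e / d := by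
  rw [map_div₀, hd, he, mul_div_mul_left _ _ hB]

theorem InKernel.add {y z : K} (hy : InKernel σ B y) (hz : InKernel σ B z) :
    InKernel σ B (y + z) := by
  unfold InKernel at *
  simp only [map_add, hy, hz]
  ring

theorem InKernel.mul {c y : K} (hc : σ c = c) (hy : InKernel σ B y) :
    InKernel σ B (c * y) := by
  unfold InKernel at *
  simp only [map_mul, hc, hy]
  ring

/-- The properties of the additive map `S x = ∑ x ^ (2 ^ i)` attached to a power `σ` of the
Frobenius map. -/
structure IsArtinSchreier (σ : K →+* K) (S : K →+ K) : Prop where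
  sq : ∀ x, S (x ^ 2) = S x ^ 2
  comm : ∀ x, S (σ x) = σ (S x)
  sq_add_self : ∀ x, S x ^ 2 + S x = σ x + x

/-- `ψ` fixes `B` and the fixed field of `σ`, and commutes with `σ` and `S`. -/
structure IsCompatible (σ : K →+* K) (S : K →+ K) (B : K) (ψ : K →+* K) : Prop where
  comm : ∀ x, ψ (σ x) = σ (ψ x)
  commS : ∀ x, ψ (S x) = S (ψ x)
  map_const : ψ B = B
  fix : ∀ c, σ c = c → ψ c = c

/-- `ψ` acts on the kernel of `σ² + σ + B` as a scalar of the fixed field of `σ`. -/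
def ActsAsScalar (σ : K →+* K) (B : K) (ψ : K →+* K) : Prop :=
  ∃ c, σ c = c ∧ ∀ y, InKernel σ B y → ψ y = c * y

theorem IsCompatible.inKernel (h : IsCompatible σ S B ψ) {y : K} (hy : InKernel σ B y) :
    InKernel σ B (ψ y) := by
  unfold InKernel at *
  rw [← h.comm, ← h.comm, hy, map_add, map_mul, h.map_const]

theorem IsCompatible.map_moore (h : IsCompatible σ S B ψ) (y z : K) :
    ψ (moore σ y z) = moore σ (ψ y) (ψ z) := by
  simp only [moore, map_add, map_mul, h.comm]

/-- The nonzero solutions of `x * T(x) ^ (q + 1) = 1 / B`, in terms of `S x = x * T(x)`. -/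
def IsMCMRoot (σ : K →+* K) (S : K →+ K) (B x : K) : Prop :=
  x ≠ 0 ∧ σ x = B * (S x * σ (S x))

theorem IsMCMRoot.sum_ne_zero {x : K} (hx : IsMCMRoot σ S B x) : S x ≠ 0 := by
  intro h
  have := hx.2
  rw [h] at this
  simp only [zero_mul, mul_zero, map_eq_zero] at this
  exact hx.1 this

variable [CharP K 2]

theorem moore_map {y z : K} (hy : InKernel σ B y) (hz : InKernel σ B z) :
    σ (moore σ y z) = B * moore σ y z := by
  unfold InKernel moore at *
  simp only [map_add, map_mul, hy, hz]
  grind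

/-- Cramer's rule: `σ` multiplies every Moore determinant of kernel elements by `B`, so their
quotients lie in the fixed field. -/
theorem exists_coords (hB : B ≠ 0) {y₁ y₂ y : K} (h₁ : InKernel σ B y₁)
    (h₂ : InKernel σ B y₂) (hD : moore σ y₁ y₂ ≠ 0) (hy : InKernel σ B y) :
    ∃ c₁ c₂, σ c₁ = c₁ ∧ σ c₂ = c₂ ∧ y = c₁ * y₁ + c₂ * y₂ := by
  refine ⟨moore σ y y₂ / moore σ y₁ y₂, moore σ y₁ y / moore σ y₁ y₂,
    map_div_of_map_eq_mul hB (moore_map h₁ h₂) (moore_map hy h₂),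
    map_div_of_map_eq_mul hB (moore_map h₁ h₂) (moore_map h₁ hy), ?_⟩
  field_simp
  unfold moore
  grind

theorem eq_zero_of_lin_dep {y₁ y₂ c₁ c₂ : K} (hD : moore σ y₁ y₂ ≠ 0) (h₁ : σ c₁ = c₁)
    (h₂ : σ c₂ = c₂) (h : c₁ * y₁ + c₂ * y₂ = 0) : c₁ = 0 ∧ c₂ = 0 := by
  have h' : c₁ * σ y₁ + c₂ * σ y₂ = 0 := by
    have := congrArg σ h
    simpa only [map_add, map_mul, h₁, h₂, map_zero] using this
  unfold moore at hD
  constructor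
  · refine (mul_eq_zero.mp ?_).resolve_right hD
    grind
  · refine (mul_eq_zero.mp ?_).resolve_right hD
    grind

/-- The Moore determinant of the squares is the square of the Moore determinant. This allows
coefficients of `y₁²` and `y₂²` to be compared. -/
theorem eq_zero_of_sq_lin_dep {y₁ y₂ c₁ c₂ : K} (hD : moore σ y₁ y₂ ≠ 0) (h₁ : σ c₁ = c₁)
    (h₂ : σ c₂ = c₂) (h : c₁ * y₁ ^ 2 + c₂ * y₂ ^ 2 = 0) : c₁ = 0 ∧ c₂ = 0 := by
  have h' : c₁ * σ y₁ ^ 2 + c₂ * σ y₂ ^ 2 = 0 := by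
    have := congrArg σ h
    simpa only [map_add, map_mul, map_pow, h₁, h₂, map_zero] using this
  have hD := pow_ne_zero 2 hD
  unfold moore at hD
  constructor
  · refine (mul_eq_zero.mp ?_).resolve_right hD
    grind
  · refine (mul_eq_zero.mp ?_).resolve_right hD
    grind

theorem map_div_of_moore_eq_zero {y z : K} (hy : y ≠ 0) (h : moore σ y z = 0) :
    σ (z / y) = z / y := by
  have hy' : σ y ≠ 0 := (map_ne_zero σ).mpr hy
  unfold moore at h
  rw [map_div₀, div_eq_div_iff hy' hy]
  grind

theorem IsCompatible.actsAsScalar_of_basis (h : IsCompatible σ S B ψ) (hB : B ≠ 0) {y₁ y₂ c : K}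
    (h₁ : InKernel σ B y₁) (h₂ : InKernel σ B y₂) (hD : moore σ y₁ y₂ ≠ 0) (hc : σ c = c)
    (hc₁ : ψ y₁ = c * y₁) (hc₂ : ψ y₂ = c * y₂) : ActsAsScalar σ B ψ := by
  refine ⟨c, hc, fun y hy => ?_⟩
  obtain ⟨a₁, a₂, ha₁, ha₂, rfl⟩ := exists_coords hB h₁ h₂ hD hy
  rw [map_add, map_mul, map_mul, h.fix _ ha₁, h.fix _ ha₂, hc₁, hc₂]
  ring

/-- The third eigenvector has two nonzero coordinates in the basis of the first two, which forces
all eigenvalues to agree. -/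
theorem IsCompatible.actsAsScalar_of_three (h : IsCompatible σ S B ψ) (hB : B ≠ 0)
    {y₁ y₂ y₃ c₁ c₂ c₃ : K}
    (h₁ : InKernel σ B y₁) (h₂ : InKernel σ B y₂) (h₃ : InKernel σ B y₃)
    (hD : moore σ y₁ y₂ ≠ 0) (hD₁ : moore σ y₁ y₃ ≠ 0) (hD₂ : moore σ y₂ y₃ ≠ 0)
    (hc₁ : σ c₁ = c₁) (hc₂ : σ c₂ = c₂) (hc₃ : σ c₃ = c₃)
    (e₁ : ψ y₁ = c₁ * y₁) (e₂ : ψ y₂ = c₂ * y₂) (e₃ : ψ y₃ = c₃ * y₃) :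
    ActsAsScalar σ B ψ := by
  obtain ⟨a₁, a₂, ha₁, ha₂, rfl⟩ := exists_coords hB h₁ h₂ hD h₃
  have key : (a₁ * (c₁ + c₃)) * y₁ + (a₂ * (c₂ + c₃)) * y₂ = 0 := by
    rw [map_add, map_mul, map_mul, h.fix _ ha₁, h.fix _ ha₂, e₁, e₂] at e₃
    grind
  have hn₁ : a₁ ≠ 0 := by
    rintro rfl
    apply hD₂
    simp only [moore, zero_mul, zero_add, map_mul, ha₂]
    grind
  have hn₂ : a₂ ≠ 0 := by
    rintro rfl
    apply hD₁
    simp only [moore, zero_mul, add_zero, map_mul, ha₁]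
    grind
  obtain ⟨k₁, k₂⟩ := eq_zero_of_lin_dep hD (by simp only [map_add, map_mul, ha₁, hc₁, hc₃])
    (by simp only [map_add, map_mul, ha₂, hc₂, hc₃]) key
  have k₁' := (mul_eq_zero.mp k₁).resolve_left hn₁
  have k₂' := (mul_eq_zero.mp k₂).resolve_left hn₂
  refine h.actsAsScalar_of_basis hB h₁ h₂ hD hc₁ e₁ ?_
  rw [e₂]
  grind

/-! ### Roots of `C + a` as anisotropic binary quadratic forms -/

theorem IsMCMRoot.eq (hS : IsArtinSchreier σ S) {x : K} (hx : IsMCMRoot σ S B x) :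
    x = S x ^ 2 + S x + B * (S x * σ (S x)) := by
  have := hS.sq_add_self x
  rw [hx.2] at this
  grind

/-- Apply `σ` to `x = s² + s + B s σ(s)`, equate with `σ x = B s σ(s)`, and cancel `σ s`. -/
theorem IsMCMRoot.affine (hS : IsArtinSchreier σ S) {x : K} (hx : IsMCMRoot σ S B x) :
    σ B * σ (σ (S x)) = σ (S x) + B * S x + 1 := by
  have h0 : σ (S x) ≠ 0 := (map_ne_zero σ).mpr hx.sum_ne_zero
  have h1 := congrArg σ (hx.eq hS)
  rw [hx.2] at h1
  simp only [map_add, map_mul, map_pow] at h1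
  refine mul_left_cancel₀ h0 ?_
  grind

/-- If `s` is the value of the form `α X² + X Y + γ Y²` divided by the Moore determinant, then
`s` satisfies an affine equation. -/
theorem affine_of_form (hB : B ≠ 0) {y₁ y₂ α γ s : K} (h₁ : InKernel σ B y₁)
    (h₂ : InKernel σ B y₂) (hD : moore σ y₁ y₂ ≠ 0) (hα : σ α = α) (hγ : σ γ = γ)
    (hs : s * moore σ y₁ y₂ = α * y₁ ^ 2 + y₁ * y₂ + γ * y₂ ^ 2) :
    σ B * σ (σ s) = σ s + B * s + 1 := by
  have hm := moore_map h₁ h₂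
  have e₁ := congrArg σ hs
  simp only [map_add, map_mul, map_pow, hα, hγ, hm] at e₁
  have e₂ := congrArg σ e₁
  unfold InKernel at h₁ h₂
  simp only [map_add, map_mul, map_pow, hα, hγ, hm, h₁, h₂] at e₂
  refine mul_left_cancel₀ (mul_ne_zero hB hD) ?_
  have e₃ : B * moore σ y₁ y₂ = B * (y₁ * σ y₂ + y₂ * σ y₁) := rfl
  grind

theorem map_sum_of_form (hS : IsArtinSchreier σ S) (hB : B ≠ 0) {y₁ y₂ α γ s x : K}
    (h₁ : InKernel σ B y₁)
    (h₂ : InKernel σ B y₂) (hD : moore σ y₁ y₂ ≠ 0) (hα : σ α = α) (hγ : σ γ = γ)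
    (hs : s * moore σ y₁ y₂ = α * y₁ ^ 2 + y₁ * y₂ + γ * y₂ ^ 2)
    (hx : x = s ^ 2 + s + B * (s * σ s)) :
    σ x = B * (s * σ s) ∧ σ (S x) = σ s + 1 + S (α * γ) := by
  have hE := affine_of_form hB h₁ h₂ hD hα hγ hs
  have hm := moore_map h₁ h₂
  have e₁ := congrArg σ hs
  simp only [map_add, map_mul, map_pow, hα, hγ, hm] at e₁
  have hσx : σ x = B * (s * σ s) := by
    rw [hx]
    simp only [map_add, map_mul, map_pow]
    grind
  refine ⟨hσx, ?_⟩
  set D := moore σ y₁ y₂ with hDdef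
  have hDe : D = y₁ * σ y₂ + y₂ * σ y₁ := rfl
  -- `p` comes from composition of forms: `Q(y) Q(σ y)` is the value of `X² + X Y + α γ Y²` at `(p
  -- D, D)`. Since also `Q(y) Q(σ y) = B s σ(s) D²`, this gives `σ x = p² + p + α γ`, to which `S`
  -- can be applied.
  set p := (α * y₁ * σ y₁ + γ * y₂ * σ y₂ + y₁ * σ y₂) / D with hp
  have hpD : p * D = α * y₁ * σ y₁ + γ * y₂ * σ y₂ + y₁ * σ y₂ := div_mul_cancel₀ _ hD
  have e₂ : p ^ 2 + p + α * γ = B * (s * σ s) := by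
    refine mul_right_cancel₀ (pow_ne_zero 2 hD) ?_
    have : B * (s * σ s) * D ^ 2 = (s * D) * (σ s * (B * D)) := by ring
    rw [this, hs, e₁]
    have : (p ^ 2 + p + α * γ) * D ^ 2 = (p * D) ^ 2 + (p * D) * D + α * γ * D ^ 2 := by ring
    rw [this, hpD, hDe]
    grind
  have e₃ : σ p = p + σ s + 1 := by
    have h := congrArg σ hpD
    unfold InKernel at h₁ h₂
    simp only [map_add, map_mul, hα, hγ, hm, h₁, h₂] at h
    refine mul_right_cancel₀ (mul_ne_zero hB hD) ?_
    have : (p + σ s + 1) * (B * D) = B * (p * D) + σ s * (B * D) + B * D := by ring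
    rw [this, h, hpD, e₁, hDe]
    grind
  have e₄ := hS.sq_add_self p
  rw [← hS.comm, hσx, ← e₂, map_add, map_add, hS.sq, e₄, e₃]
  grind

theorem isMCMRoot_of_form (hS : IsArtinSchreier σ S) (hB : B ≠ 0) {y₁ y₂ α γ s x : K}
    (h₁ : InKernel σ B y₁)
    (h₂ : InKernel σ B y₂) (hD : moore σ y₁ y₂ ≠ 0) (hα : σ α = α) (hγ : σ γ = γ)
    (hs : s * moore σ y₁ y₂ = α * y₁ ^ 2 + y₁ * y₂ + γ * y₂ ^ 2)
    (hx : x = s ^ 2 + s + B * (s * σ s)) (h : S (α * γ) = 1) :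
    IsMCMRoot σ S B x ∧ S x = s := by
  obtain ⟨e₁, e₂⟩ := map_sum_of_form hS hB h₁ h₂ hD hα hγ hs hx
  have e₃ : S x = s := by
    apply σ.injective
    rw [e₂, h]
    grind
  refine ⟨⟨?_, by rw [e₁, e₃]⟩, e₃⟩
  rintro rfl
  rw [map_zero] at e₃
  have := affine_of_form hB h₁ h₂ hD hα hγ hs
  rw [← e₃] at this
  simp at this

theorem IsMCMRoot.exists_form (hS : IsArtinSchreier σ S) (hB : B ≠ 0) {y₁ y₂ x : K}
    (h₁ : InKernel σ B y₁)
    (h₂ : InKernel σ B y₂) (hD : moore σ y₁ y₂ ≠ 0) (hx : IsMCMRoot σ S B x) :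
    ∃ α γ, σ α = α ∧ σ γ = γ ∧ S (α * γ) = 1 ∧
      S x * moore σ y₁ y₂ = α * y₁ ^ 2 + y₁ * y₂ + γ * y₂ ^ 2 := by
  have hE := hx.affine hS
  have hm := moore_map h₁ h₂
  set D := moore σ y₁ y₂ with hDdef
  have hDe : D = y₁ * σ y₂ + y₂ * σ y₁ := rfl
  set s := S x with hsdef
  -- `y₁ y₂ / D` solves the same affine equation as `s`, so their difference is homogeneous. Scaled
  -- by `D`, it lies in the kernel of `σ² + σ + B²`, which is spanned by `y₁²` and `y₂²`; Cramer's
  -- rule then yields `α` and `γ`.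
  obtain ⟨e, he⟩ : ∃ e, e = s * D + y₁ * y₂ := ⟨_, rfl⟩
  have he₁ : σ e = σ s * (B * D) + σ y₁ * σ y₂ := by
    rw [he]
    simp only [map_add, map_mul, hm]
  have h₁' := h₁
  have h₂' := h₂
  unfold InKernel at h₁' h₂'
  have he₂ : σ (σ e) = σ e + B ^ 2 * e := by
    have : σ (σ s) * (σ B * (B * D)) = (σ B * σ (σ s)) * (B * D) := by ring
    rw [he₁]
    simp only [map_add, map_mul, hm, h₁', h₂']
    rw [this, hE, he, hDe]
    grind
  have hnum : ∀ y, InKernel σ B y → σ (e * σ y ^ 2 + σ e * y ^ 2) =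
      B ^ 2 * (e * σ y ^ 2 + σ e * y ^ 2) := by
    intro y hy
    unfold InKernel at hy
    simp only [map_add, map_mul, map_pow, hy, he₂]
    grind
  have hm2 : σ (D ^ 2) = B ^ 2 * D ^ 2 := by rw [map_pow, hm]; ring
  have hα := map_div_of_map_eq_mul (pow_ne_zero 2 hB) hm2 (hnum y₂ h₂)
  have hγ := map_div_of_map_eq_mul (pow_ne_zero 2 hB) hm2 (hnum y₁ h₁)
  have hform : s * D = (e * σ y₂ ^ 2 + σ e * y₂ ^ 2) / D ^ 2 * y₁ ^ 2 + y₁ * y₂ +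
      (e * σ y₁ ^ 2 + σ e * y₁ ^ 2) / D ^ 2 * y₂ ^ 2 := by
    have : s * D = e + y₁ * y₂ := by grind
    rw [this]
    field_simp
    rw [hDe]
    grind
  refine ⟨_, _, hα, hγ, ?_, hform⟩
  have := (map_sum_of_form hS hB h₁ h₂ hD hα hγ hform (hx.eq hS)).2
  rw [← hsdef] at this
  grind

/-! ### Which forms a linear map fixes -/

theorem IsMCMRoot.map_eq_iff (hS : IsArtinSchreier σ S) (h : IsCompatible σ S B ψ) {x : K}
    (hx : IsMCMRoot σ S B x) : ψ x = x ↔ ψ (S x) = S x := by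
  constructor
  · intro hψ
    rw [h.commS, hψ]
  · intro hψ
    rw [hx.eq hS]
    simp only [map_add, map_mul, map_pow, h.comm, h.map_const, hψ]

theorem IsMCMRoot.map_eq_iff_form (hS : IsArtinSchreier σ S) (h : IsCompatible σ S B ψ)
    {y₁ y₂ x α γ d : K} (hD : moore σ y₁ y₂ ≠ 0) (hd : d ≠ 0)
    (hψD : ψ (moore σ y₁ y₂) = d * moore σ y₁ y₂)
    (hx : IsMCMRoot σ S B x) (hα : σ α = α) (hγ : σ γ = γ)
    (hs : S x * moore σ y₁ y₂ = α * y₁ ^ 2 + y₁ * y₂ + γ * y₂ ^ 2) :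
    ψ x = x ↔ α * ψ y₁ ^ 2 + ψ y₁ * ψ y₂ + γ * ψ y₂ ^ 2 =
      d * (α * y₁ ^ 2 + y₁ * y₂ + γ * y₂ ^ 2) := by
  rw [hx.map_eq_iff hS h]
  have e := congrArg ψ hs
  simp only [map_add, map_mul, map_pow, h.fix _ hα, h.fix _ hγ, hψD] at e
  rw [← e, ← hs, mul_left_comm d, mul_left_inj' (mul_ne_zero hd hD)]

theorem IsMCMRoot.map_eq_of_actsAsScalar (hS : IsArtinSchreier σ S) (hB : B ≠ 0)
    (h : IsCompatible σ S B ψ) (hψ : ActsAsScalar σ B ψ) {y₁ y₂ x : K}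
    (h₁ : InKernel σ B y₁) (h₂ : InKernel σ B y₂) (hD : moore σ y₁ y₂ ≠ 0)
    (hx : IsMCMRoot σ S B x) : ψ x = x := by
  obtain ⟨α, γ, hα, hγ, -, hs⟩ := hx.exists_form hS hB h₁ h₂ hD
  obtain ⟨c, hc, hψ⟩ := hψ
  have hc0 : c ≠ 0 := by
    rintro rfl
    have : ψ y₁ = 0 := by rw [hψ _ h₁, zero_mul]
    rw [map_eq_zero] at this
    simp [moore, this] at hD
  rw [hx.map_eq_iff_form hS h hD (pow_ne_zero 2 hc0) ?_ hα hγ hs, hψ _ h₁, hψ _ h₂]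
  · ring
  · rw [h.map_moore, hψ _ h₁, hψ _ h₂]
    simp only [moore, map_mul, hc]
    ring

/-- Invariance gives `α c₁ (c₁ + c₂) = 0`, and `α ≠ 0` because `S (α γ) = 1`. -/
theorem IsMCMRoot.eq_of_two_eigenvectors (hS : IsArtinSchreier σ S) (hB : B ≠ 0)
    (h : IsCompatible σ S B ψ) {y₁ y₂ x c₁ c₂ : K}
    (h₁ : InKernel σ B y₁) (h₂ : InKernel σ B y₂) (hD : moore σ y₁ y₂ ≠ 0)
    (hc₁ : σ c₁ = c₁) (hc₂ : σ c₂ = c₂) (e₁ : ψ y₁ = c₁ * y₁) (e₂ : ψ y₂ = c₂ * y₂)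
    (hx : IsMCMRoot σ S B x) (hψ : ψ x = x) : c₁ = c₂ := by
  obtain ⟨α, γ, hα, hγ, hαγ, hs⟩ := hx.exists_form hS hB h₁ h₂ hD
  have hy₁ : y₁ ≠ 0 := by rintro rfl; simp [moore] at hD
  have hy₂ : y₂ ≠ 0 := by rintro rfl; simp [moore] at hD
  have hn₁ : c₁ ≠ 0 := by
    rintro rfl
    rw [zero_mul, map_eq_zero] at e₁
    exact hy₁ e₁
  have hn₂ : c₂ ≠ 0 := by
    rintro rfl
    rw [zero_mul, map_eq_zero] at e₂
    exact hy₂ e₂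
  rw [hx.map_eq_iff_form hS h hD (mul_ne_zero hn₁ hn₂) ?_ hα hγ hs, e₁, e₂] at hψ
  · have := eq_zero_of_sq_lin_dep (c₁ := α * c₁ * (c₁ + c₂)) (c₂ := γ * c₂ * (c₁ + c₂)) hD
      (by simp only [map_add, map_mul, hα, hc₁, hc₂])
      (by simp only [map_add, map_mul, hγ, hc₁, hc₂]) (by grind)
    have hα0 : α ≠ 0 := by
      rintro rfl
      rw [zero_mul, map_zero] at hαγ
      exact zero_ne_one hαγ
    have := (mul_eq_zero.mp this.1).resolve_left (mul_ne_zero hα0 hn₁)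
    grind
  · rw [h.map_moore, e₁, e₂]
    simp only [moore, map_mul, hc₁, hc₂]
    ring

/-- Without eigenvectors, `X² + t X + d` has no root in F_q. The value `S (d / t²) = 1` is the
Artin–Schreier criterion for this. -/
theorem exists_form_of_forall_ne [IsAlgClosed K] (hS : IsArtinSchreier σ S) (hB : B ≠ 0)
    (h : IsCompatible σ S B ψ)
    (hno : ∀ y c, InKernel σ B y → y ≠ 0 → σ c = c → ψ y ≠ c * y) {y₁ : K}
    (h₁ : InKernel σ B y₁) (hy₁ : y₁ ≠ 0) :
    moore σ y₁ (ψ y₁) ≠ 0 ∧ ∃ d t, σ d = d ∧ σ t = t ∧ d ≠ 0 ∧ t ≠ 0 ∧ S (d / t ^ 2) = 1 ∧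
      ψ (ψ y₁) = d * y₁ + t * ψ y₁ := by
  have h₂ := h.inKernel h₁
  have hD : moore σ y₁ (ψ y₁) ≠ 0 := fun h0 =>
    hno y₁ _ h₁ hy₁ (map_div_of_moore_eq_zero hy₁ h0) (div_mul_cancel₀ _ hy₁).symm
  refine ⟨hD, ?_⟩
  obtain ⟨d, t, hd, ht, e⟩ := exists_coords hB h₁ h₂ hD (h.inKernel h₂)
  have hne : ∀ r, σ r = r → r ^ 2 + t * r + d ≠ 0 := by
    intro r hr h0
    have hrt : σ (r + t) = r + t := by rw [map_add, hr, ht]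
    -- By Cayley–Hamilton, applying `ψ + r + t` to `y₁` gives an eigenvector for a root `r`.
    refine hno (ψ y₁ + (r + t) * y₁) r (h₂.add (h₁.mul hrt)) ?_ hr ?_
    · intro h1
      have := (eq_zero_of_lin_dep (c₁ := r + t) (c₂ := 1) hD hrt (map_one σ)
        (by rw [← h1]; ring)).2
      exact one_ne_zero this
    · rw [map_add, map_mul, h.fix _ hrt, e]
      grind
  have hd0 : d ≠ 0 := by
    rintro rfl
    exact hne 0 (map_zero σ) (by ring)
  -- If `t = 0`, the square root of `d` is fixed by `σ` and is a root.
  have ht0 : t ≠ 0 := by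
    rintro rfl
    obtain ⟨r, hr⟩ := IsAlgClosed.exists_pow_nat_eq d (n := 2) two_pos
    refine hne r ?_ (by grind)
    have h3 : (σ r + r) ^ 2 = 0 := by
      have := congrArg σ hr
      rw [map_pow, hd] at this
      grind
    have := pow_eq_zero_iff two_ne_zero |>.mp h3
    grind
  refine ⟨d, t, hd, ht, hd0, ht0, ?_, e⟩
  obtain ⟨r, hr⟩ : ∃ r, r ^ 2 + r = d / t ^ 2 := by
    have hdeg : (X ^ 2 + X - C (d / t ^ 2) : K[X]).degree ≠ 0 := by
      have : (X ^ 2 + X - C (d / t ^ 2) : K[X]).degree = 2 := by compute_degree!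
      rw [this]
      decide
    obtain ⟨r, hr⟩ := IsAlgClosed.exists_root _ hdeg
    refine ⟨r, ?_⟩
    simp only [IsRoot, eval_sub, eval_add, eval_pow, eval_X, eval_C] at hr
    exact sub_eq_zero.mp hr
  have hk : S (d / t ^ 2) ^ 2 + S (d / t ^ 2) = 0 := by
    rw [hS.sq_add_self, map_div₀, map_pow, hd, ht, CharTwo.add_self_eq_zero]
  -- With `r² + r = d / t²`, `S (d / t²) = σ r + r`; if this vanishes, `t r` is a root in F_q.
  have hn : S (d / t ^ 2) ≠ 0 := by
    intro h0
    rw [← hr, map_add, hS.sq, hS.sq_add_self] at h0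
    have hσr : σ r = r := by grind
    refine hne (t * r) (by rw [map_mul, ht, hσr]) ?_
    have : r ^ 2 * t ^ 2 + r * t ^ 2 = d := by
      rw [← add_mul, hr, div_mul_cancel₀ _ (pow_ne_zero 2 ht0)]
    grind
  have : S (d / t ^ 2) * (S (d / t ^ 2) + 1) = 0 := by rw [← hk]; ring
  have := (mul_eq_zero.mp this).resolve_left hn
  grind

/-- In the basis `y₁, ψ y₁`, comparing coefficients leaves only the form `(d X² + t X Y + Y²) / t`.
-/
theorem existsUnique_isMCMRoot [IsAlgClosed K] (hS : IsArtinSchreier σ S) (hB : B ≠ 0)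
    (h : IsCompatible σ S B ψ)
    (hno : ∀ y c, InKernel σ B y → y ≠ 0 → σ c = c → ψ y ≠ c * y) {y₁ : K}
    (h₁ : InKernel σ B y₁) (hy₁ : y₁ ≠ 0) :
    ∃! x, IsMCMRoot σ S B x ∧ ψ x = x := by
  obtain ⟨hD, d, t, hd, ht, hd0, ht0, hdt, e⟩ := exists_form_of_forall_ne hS hB h hno h₁ hy₁
  have h₂ := h.inKernel h₁
  have hψD : ψ (moore σ y₁ (ψ y₁)) = d * moore σ y₁ (ψ y₁) := by
    rw [h.map_moore, e]
    simp only [moore, map_add, map_mul, hd, ht]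
    grind
  have key : ∀ x α γ, IsMCMRoot σ S B x → σ α = α → σ γ = γ →
      S x * moore σ y₁ (ψ y₁) = α * y₁ ^ 2 + y₁ * ψ y₁ + γ * (ψ y₁) ^ 2 →
      (ψ x = x ↔ α = d / t ∧ γ = 1 / t) := by
    intro x α γ hx hα hγ hs
    rw [hx.map_eq_iff_form hS h hD hd0 hψD hα hγ hs, e]
    constructor
    · intro h0
      obtain ⟨k₁, k₂⟩ := eq_zero_of_sq_lin_dep (c₁ := d * α + γ * d ^ 2)
        (c₂ := α + t + γ * t ^ 2 + d * γ) hD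
        (by simp only [map_add, map_mul, map_pow, hd, hα, hγ])
        (by simp only [map_add, map_mul, map_pow, hd, hα, hγ, ht]) (by grind)
      have k₃ : α = γ * d := by
        refine mul_left_cancel₀ hd0 ?_
        grind
      have k₄ : γ = 1 / t := by
        rw [eq_div_iff ht0]
        refine mul_left_cancel₀ ht0 ?_
        grind
      exact ⟨by rw [k₃, k₄]; ring, k₄⟩
    · rintro ⟨rfl, rfl⟩
      field_simp
      grind
  have hα : σ (d / t) = d / t := by rw [map_div₀, hd, ht]
  have hγ : σ (1 / t) = 1 / t := by rw [map_div₀, map_one, ht]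
  have hs := div_mul_cancel₀ (d / t * y₁ ^ 2 + y₁ * ψ y₁ + 1 / t * (ψ y₁) ^ 2) hD
  obtain ⟨hx, hSx⟩ := isMCMRoot_of_form hS hB h₁ h₂ hD hα hγ hs rfl
    (by rw [show d / t * (1 / t) = d / t ^ 2 by field_simp, hdt])
  refine ⟨_, ⟨hx, (key _ _ _ hx hα hγ (by rw [hSx, hs])).mpr ⟨rfl, rfl⟩⟩, ?_⟩
  rintro x ⟨hx', hψx'⟩
  obtain ⟨α, γ, hα', hγ', -, hs'⟩ := hx'.exists_form hS hB h₁ h₂ hD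
  obtain ⟨rfl, rfl⟩ := (key _ _ _ hx' hα' hγ' hs').mp hψx'
  have : S x = (d / t * y₁ ^ 2 + y₁ * ψ y₁ + 1 / t * (ψ y₁) ^ 2) / moore σ y₁ (ψ y₁) := by
    rw [eq_div_iff hD, hs']
  rw [hx'.eq hS, this]

/-- Invariance fixes `γ = c / b` and leaves `α` free, so the fixed roots are parametrized by `β = α
γ` with `S β = 1`. -/
theorem ncard_isMCMRoot_of_unipotent (hS : IsArtinSchreier σ S) (hB : B ≠ 0)
    (h : IsCompatible σ S B ψ) {y₁ y₂ c b : K}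
    (h₁ : InKernel σ B y₁) (h₂ : InKernel σ B y₂) (hD : moore σ y₁ y₂ ≠ 0)
    (hc : σ c = c) (hb : σ b = b) (hb0 : b ≠ 0)
    (e₁ : ψ y₁ = c * y₁) (e₂ : ψ y₂ = c * y₂ + b * y₁) :
    {x | IsMCMRoot σ S B x ∧ ψ x = x}.ncard = {β | S β = 1}.ncard := by
  have hy₁ : y₁ ≠ 0 := by rintro rfl; simp [moore] at hD
  have hc0 : c ≠ 0 := by
    rintro rfl
    rw [zero_mul, map_eq_zero] at e₁
    exact hy₁ e₁
  have hψD : ψ (moore σ y₁ y₂) = c ^ 2 * moore σ y₁ y₂ := by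
    rw [h.map_moore, e₁, e₂]
    simp only [moore, map_add, map_mul, hc, hb]
    grind
  have key : ∀ x α γ, IsMCMRoot σ S B x → σ α = α → σ γ = γ →
      S x * moore σ y₁ y₂ = α * y₁ ^ 2 + y₁ * y₂ + γ * y₂ ^ 2 →
      (ψ x = x ↔ γ = c / b) := by
    intro x α γ hx hα hγ hs
    rw [hx.map_eq_iff_form hS h hD (pow_ne_zero 2 hc0) hψD hα hγ hs, e₁, e₂, eq_div_iff hb0]
    constructor
    · intro h0
      refine mul_left_cancel₀ (mul_ne_zero hb0 (pow_ne_zero 2 hy₁)) ?_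
      grind
    · intro h0
      grind
  have hγ : σ (c / b) = c / b := by rw [map_div₀, hb, hc]
  have hγ0 : c / b ≠ 0 := div_ne_zero hc0 hb0
  have hβfix : ∀ β, S β = 1 → σ β = β := by
    intro β hβ
    have := hS.sq_add_self β
    rw [hβ] at this
    grind
  let s : K → K := fun β =>
    (β / (c / b) * y₁ ^ 2 + y₁ * y₂ + c / b * y₂ ^ 2) / moore σ y₁ y₂
  have hs : ∀ β, s β * moore σ y₁ y₂ = β / (c / b) * y₁ ^ 2 + y₁ * y₂ + c / b * y₂ ^ 2 :=
    fun β => div_mul_cancel₀ _ hD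
  have hα : ∀ β, S β = 1 → σ (β / (c / b)) = β / (c / b) := by
    intro β hβ
    rw [map_div₀, hγ, hβfix β hβ]
  have hx : ∀ β, S β = 1 → IsMCMRoot σ S B (s β ^ 2 + s β + B * (s β * σ (s β))) ∧
      S (s β ^ 2 + s β + B * (s β * σ (s β))) = s β := by
    intro β hβ
    exact isMCMRoot_of_form hS hB h₁ h₂ hD (hα β hβ) hγ (hs β) rfl
      (by rw [div_mul_cancel₀ _ hγ0, hβ])
  symm
  refine Set.BijOn.ncard_eq (f := fun β => s β ^ 2 + s β + B * (s β * σ (s β))) ⟨?_, ?_, ?_⟩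
  · intro β hβ
    obtain ⟨k₁, k₂⟩ := hx β hβ
    exact ⟨k₁, (key _ _ _ k₁ (hα β hβ) hγ (by rw [k₂, hs])).mpr rfl⟩
  · intro β hβ β' hβ' heq
    have e : s β = s β' := by
      rw [← (hx β hβ).2, ← (hx β' hβ').2]
      exact congrArg S heq
    have e' : s β * moore σ y₁ y₂ = s β' * moore σ y₁ y₂ := by rw [e]
    rw [hs, hs, add_left_inj, add_left_inj, mul_left_inj' (pow_ne_zero 2 hy₁)] at e'
    exact (div_left_inj' hγ0).mp e'
  · rintro x ⟨hx', hψx⟩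
    obtain ⟨α, γ, hα', hγ', hαγ, hs'⟩ := hx'.exists_form hS hB h₁ h₂ hD
    obtain rfl := (key _ _ _ hx' hα' hγ' hs').mp hψx
    refine ⟨α * (c / b), hαγ, ?_⟩
    have : s (α * (c / b)) = S x := by
      refine mul_right_cancel₀ hD ?_
      rw [hs, hs', mul_div_cancel_right₀ _ hγ0]
    simp only [this]
    exact (hx'.eq hS).symm

end LinearizedKernel

/-! ### Factor degrees from Frobenius orbits -/

section FactorType

variable {F : Type*} [Field F]

theorem ncard_rootSet_self {g : F[X]} (hg : g.Separable) :
    (g.rootSet F).ncard = Multiset.card g.roots := by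
  classical
  rw [rootSet_def, Set.ncard_coe_finset, aroots_def, Algebra.algebraMap_self, Polynomial.map_id,
    Multiset.toFinset_card_of_nodup (nodup_roots hg)]

theorem card_roots_of_irreducible {p : F[X]} (hp : Irreducible p) :
    Multiset.card p.roots = if p.natDegree = 1 then 1 else 0 := by
  split_ifs with h
  · rw [splits_iff_card_roots.mp (Splits.of_natDegree_eq_one h), h]
  · rw [Multiset.card_eq_zero]
    by_contra hne
    obtain ⟨x, hx⟩ := Multiset.exists_mem_of_ne_zero hne
    have := degree_eq_one_of_irreducible_of_root hp (isRoot_of_mem_roots hx)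
    exact h (natDegree_eq_of_degree_eq_some this)

theorem Multiset.eq_replicate_add_replicate {α : Type*} [DecidableEq α] {a b : α} (hab : a ≠ b)
    (s : Multiset α) (h : ∀ x ∈ s, x = a ∨ x = b) :
    s = Multiset.replicate (s.count a) a + Multiset.replicate (s.count b) b := by
  ext x
  rw [Multiset.count_add, Multiset.count_replicate, Multiset.count_replicate]
  by_cases hxa : a = x
  · subst hxa
    rw [if_pos rfl, if_neg hab.symm, add_zero]
  · by_cases hxb : b = x
    · subst hxb
      rw [if_neg hab, if_pos rfl, zero_add]
    · rw [if_neg hxa, if_neg hxb, Multiset.count_eq_zero]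
      intro hx
      rcases h x hx with rfl | rfl
      · exact hxa rfl
      · exact hxb rfl

theorem sum_map_card_roots (s : Multiset F[X]) (h : ∀ p ∈ s, Irreducible p) :
    (s.map (Multiset.card ∘ roots)).sum = (s.map natDegree).count 1 := by
  induction s using Multiset.induction with
  | empty => simp
  | cons p s ih =>
    rw [Multiset.map_cons, Multiset.sum_cons, Multiset.map_cons, Multiset.count_cons,
      ih fun q hq => h q (Multiset.mem_cons_of_mem hq), Function.comp_apply,
      card_roots_of_irreducible (h p (Multiset.mem_cons_self p s)), add_comm]
    simp only [eq_comm]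

theorem exists_hasFactorType {g : F[X]} (hg : g.Separable) {δ : ℕ} (hδ : δ ≠ 1)
    (h : ∀ p : F[X], Irreducible p → p ∣ g → p.natDegree = 1 ∨ p.natDegree = δ) :
    ∃ e, HasFactorType g
        (Multiset.replicate (g.rootSet F).ncard 1 + Multiset.replicate e δ) ∧
      (g.rootSet F).ncard + e * δ = g.natDegree := by
  classical
  have hg0 := hg.ne_zero
  set s := UniqueFactorizationMonoid.normalizedFactors g with hs
  have hirr : ∀ p ∈ s, Irreducible p := fun p hp =>
    UniqueFactorizationMonoid.irreducible_of_normalized_factor p hp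
  have hprod : Associated s.prod g := UniqueFactorizationMonoid.prod_normalizedFactors hg0
  have h0 : (0 : F[X]) ∉ s := fun h0 => (hirr 0 h0).ne_zero rfl
  have hdeg : s.prod.natDegree = g.natDegree := natDegree_eq_of_degree_eq
    (degree_eq_degree_of_associated hprod)
  have hcount : (s.map natDegree).count 1 = (g.rootSet F).ncard := by
    rw [ncard_rootSet_self hg, ← hprod.roots_eq, roots_multiset_prod _ h0, Multiset.card_bind]
    exact (sum_map_card_roots s hirr).symm
  have hrep := Multiset.eq_replicate_add_replicate hδ.symm (s.map natDegree) (by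
    intro d hd
    obtain ⟨p, hp, rfl⟩ := Multiset.mem_map.mp hd
    exact h p (hirr p hp) (UniqueFactorizationMonoid.dvd_of_mem_normalizedFactors hp))
  rw [hcount] at hrep
  refine ⟨(s.map natDegree).count δ, ⟨s, hirr, hprod, hrep⟩, ?_⟩
  conv_rhs => rw [← hdeg, natDegree_multiset_prod _ h0, hrep]
  rw [Multiset.sum_add, Multiset.sum_replicate, Multiset.sum_replicate, smul_eq_mul,
    smul_eq_mul, mul_one]

variable {K : Type*} [Field K] [Algebra F K]

theorem ncard_aeval_eq_zero [IsAlgClosed K] {g : F[X]} (hg : g.Separable) :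
    {x : K | aeval x g = 0}.ncard = g.natDegree := by
  rw [← card_rootSet_eq_natDegree hg (IsAlgClosed.splits (k := K) _), ← Nat.card_eq_fintype_card,
    Nat.card_coe_set_eq]
  congr 1
  ext x
  simp [mem_rootSet, hg.ne_zero]

variable [Finite F]

theorem natDegree_minpoly_dvd_iff {x : K} (hx : IsIntegral F x) (j : ℕ) :
    (minpoly F x).natDegree ∣ j ↔ x ^ Nat.card F ^ j = x := by
  rw [(minpoly.irreducible hx).natDegree_dvd_iff_dvd_X_pow_card_pow_sub_X,
    minpoly.dvd_iff]
  simp [sub_eq_zero]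

theorem natDegree_dvd_iff_of_aeval_eq_zero {p : F[X]} (hp : Irreducible p) {x : K}
    (hx : aeval x p = 0) (j : ℕ) : p.natDegree ∣ j ↔ x ^ Nat.card F ^ j = x := by
  have hint : IsIntegral F x := isAlgebraic_iff_isIntegral.mp ⟨p, hp.ne_zero, hx⟩
  rw [← natDegree_minpoly_dvd_iff hint, ← minpoly.eq_of_irreducible hp hx,
    natDegree_mul_C (inv_ne_zero (leadingCoeff_ne_zero.mpr hp.ne_zero))]

/-- The degree of an irreducible factor is the orbit length of any of its roots under the Frobenius
of `F`. -/
theorem exists_hasFactorType_of_orbits [IsAlgClosed K] {g : F[X]} (hg : g.Separable) {δ : ℕ}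
    (hδ : δ ≠ 1)
    (h : ∀ x : K, aeval x g = 0 → x ^ Nat.card F = x ∨ ∀ j, x ^ Nat.card F ^ j = x ↔ δ ∣ j) :
    ∃ e, HasFactorType g
        (Multiset.replicate (g.rootSet F).ncard 1 + Multiset.replicate e δ) ∧
      (g.rootSet F).ncard + e * δ = g.natDegree := by
  refine exists_hasFactorType hg hδ fun p hp hpg => ?_
  obtain ⟨x, hx⟩ := IsAlgClosed.exists_aeval_eq_zero K p (degree_pos_of_irreducible hp).ne'
  have hd := natDegree_dvd_iff_of_aeval_eq_zero hp hx
  rcases h x (aeval_eq_zero_of_dvd_aeval_eq_zero hpg hx) with h1 | h1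
  · left
    rw [← Nat.dvd_one, hd, pow_one, h1]
  · right
    exact Nat.dvd_antisymm ((hd _).mpr ((h1 _).mpr dvd_rfl)) ((h1 _).mp ((hd _).mp dvd_rfl))

theorem ncard_rootSet_eq [Algebra.IsAlgebraic F K] {g : F[X]} (hg : g ≠ 0) :
    (g.rootSet F).ncard = {x : K | aeval x g = 0 ∧ x ^ Nat.card F = x}.ncard := by
  rw [← Set.ncard_image_of_injective _ (algebraMap F K).injective]
  congr 1
  ext x
  simp only [Set.mem_image, mem_rootSet, Set.mem_ofPred_eq]
  constructor
  · rintro ⟨y, ⟨-, hy⟩, rfl⟩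
    refine ⟨by rw [aeval_algebraMap_apply, hy, map_zero], ?_⟩
    have := Fintype.ofFinite F
    rw [← map_pow, Nat.card_eq_fintype_card, FiniteField.pow_card]
  · rintro ⟨hx, hfix⟩
    have h1 := (natDegree_minpoly_dvd_iff (Algebra.IsIntegral.isIntegral (R := F) x) 1).mpr
      (by rwa [pow_one])
    obtain ⟨y, rfl⟩ := minpoly.natDegree_eq_one_iff.mp (Nat.dvd_one.mp h1)
    refine ⟨y, ⟨hg, ?_⟩, rfl⟩
    rwa [aeval_algebraMap_apply, map_eq_zero] at hx

theorem splits_of_forall_pow_card_eq [IsAlgClosed K] [Algebra.IsAlgebraic F K] {g : F[X]}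
    (hg : g.Separable) (h : ∀ x : K, aeval x g = 0 → x ^ Nat.card F = x) : g.Splits := by
  rw [splits_iff_card_roots, ← ncard_rootSet_self hg, ncard_rootSet_eq (K := K) hg.ne_zero,
    ← ncard_aeval_eq_zero (K := K) hg]
  congr 1
  ext x
  exact ⟨fun hx => hx.1, fun hx => ⟨hx, h x hx⟩⟩

end FactorType

/-! ### Roots of `x^(q+1) + x + B` as lines of `V` -/

section Lines

variable {K : Type*} [Field K] {σ : K →+* K} {S : K →+ K} {B : K} {φ ψ : K →+* K}

/-- `r` is a root of `x ^ (q + 1) + x + B`, where `σ` is the `q`-power map. -/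
def IsLineRoot (σ : K →+* K) (B r : K) : Prop := σ r * r + r + B = 0

/-- Since `ψ` commutes with `σ`, `r = σ y / y` is fixed by `ψ` exactly when `ψ y / y` is fixed by
`σ`. -/
theorem IsCompatible.map_eq_iff_exists (h : IsCompatible σ S B ψ) {y r : K}
    (hy : y ≠ 0) (hr : σ y = r * y) : ψ r = r ↔ ∃ c, σ c = c ∧ ψ y = c * y := by
  constructor
  · intro hψ
    have hσy : σ y ≠ 0 := (map_ne_zero σ).mpr hy
    have hr0 : r ≠ 0 := by
      rintro rfl
      rw [zero_mul] at hr
      exact hσy hr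
    refine ⟨ψ y / y, ?_, (div_mul_cancel₀ _ hy).symm⟩
    rw [map_div₀, ← h.comm, hr, map_mul, hψ, mul_div_mul_left _ _ hr0]
  · rintro ⟨c, hc, e⟩
    have h1 := congrArg ψ hr
    rw [h.comm, e, map_mul, map_mul, hc, hr, e] at h1
    have hc0 : c ≠ 0 := by
      rintro rfl
      rw [zero_mul, map_eq_zero] at e
      exact hy e
    refine mul_right_cancel₀ (mul_ne_zero hc0 hy) ?_
    rw [← h1]
    ring

variable [CharP K 2]

theorem IsLineRoot.inKernel {r y : K} (hr : IsLineRoot σ B r) (hy : σ y = r * y) :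
    InKernel σ B y := by
  unfold IsLineRoot at hr
  unfold InKernel
  rw [hy, map_mul, hy]
  grind

theorem InKernel.isLineRoot {y : K} (hy : InKernel σ B y) (hy0 : y ≠ 0) :
    IsLineRoot σ B (σ y / y) := by
  have hσy : σ y ≠ 0 := (map_ne_zero σ).mpr hy0
  unfold IsLineRoot
  rw [map_div₀, hy]
  field_simp
  grind

theorem moore_ne_zero {y₁ y₂ r₁ r₂ : K} (hy₁ : y₁ ≠ 0) (hy₂ : y₂ ≠ 0) (e₁ : σ y₁ = r₁ * y₁)
    (e₂ : σ y₂ = r₂ * y₂) (hr : r₁ ≠ r₂) : moore σ y₁ y₂ ≠ 0 := by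
  intro h
  have : (y₁ * y₂) * (r₁ + r₂) = 0 := by
    rw [← h, moore, e₁, e₂]
    ring
  have := (mul_eq_zero.mp this).resolve_left (mul_ne_zero hy₁ hy₂)
  grind

/-- `σ` restricts to a surjection `y ↦ σ y / y` on nonzero elements. -/
def HasEigenvectors (σ : K →+* K) : Prop := ∀ r, r ≠ 0 → ∃ y, y ≠ 0 ∧ σ y = r * y

theorem IsLineRoot.exists_vector (hσ : HasEigenvectors σ) (hB : B ≠ 0) {r : K}
    (hr : IsLineRoot σ B r) : ∃ y, y ≠ 0 ∧ σ y = r * y ∧ InKernel σ B y := by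
  have hr0 : r ≠ 0 := by
    rintro rfl
    simp only [IsLineRoot, mul_zero, zero_add] at hr
    exact hB hr
  obtain ⟨y, hy, e⟩ := hσ r hr0
  exact ⟨y, hy, e, hr.inKernel e⟩

theorem IsCompatible.map_eq_of_actsAsScalar (hσ : HasEigenvectors σ) (hB : B ≠ 0)
    (h : IsCompatible σ S B ψ) (hψ : ActsAsScalar σ B ψ) {r : K} (hr : IsLineRoot σ B r) :
    ψ r = r := by
  obtain ⟨y, hy, e, hk⟩ := hr.exists_vector hσ hB
  obtain ⟨c, hc, hψ⟩ := hψ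
  exact (h.map_eq_iff_exists hy e).mpr ⟨c, hc, hψ y hk⟩

theorem IsCompatible.actsAsScalar_of_three_roots (hσ : HasEigenvectors σ) (hB : B ≠ 0)
    (h : IsCompatible σ S B ψ) {r₁ r₂ r₃ : K} (h₁ : IsLineRoot σ B r₁) (h₂ : IsLineRoot σ B r₂)
    (h₃ : IsLineRoot σ B r₃) (h₁₂ : r₁ ≠ r₂) (h₁₃ : r₁ ≠ r₃) (h₂₃ : r₂ ≠ r₃)
    (e₁ : ψ r₁ = r₁) (e₂ : ψ r₂ = r₂) (e₃ : ψ r₃ = r₃) : ActsAsScalar σ B ψ := by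
  obtain ⟨y₁, hy₁, k₁, v₁⟩ := h₁.exists_vector hσ hB
  obtain ⟨y₂, hy₂, k₂, v₂⟩ := h₂.exists_vector hσ hB
  obtain ⟨y₃, hy₃, k₃, v₃⟩ := h₃.exists_vector hσ hB
  obtain ⟨c₁, hc₁, f₁⟩ := (h.map_eq_iff_exists hy₁ k₁).mp e₁
  obtain ⟨c₂, hc₂, f₂⟩ := (h.map_eq_iff_exists hy₂ k₂).mp e₂
  obtain ⟨c₃, hc₃, f₃⟩ := (h.map_eq_iff_exists hy₃ k₃).mp e₃
  exact h.actsAsScalar_of_three hB v₁ v₂ v₃ (moore_ne_zero hy₁ hy₂ k₁ k₂ h₁₂)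
    (moore_ne_zero hy₁ hy₃ k₁ k₃ h₁₃) (moore_ne_zero hy₂ hy₃ k₂ k₃ h₂₃) hc₁ hc₂ hc₃ f₁ f₂ f₃

theorem IsCompatible.ne_smul_of_no_root (h : IsCompatible σ S B ψ)
    (hno : ∀ r, IsLineRoot σ B r → ψ r ≠ r) (y c : K) (hk : InKernel σ B y) (hy : y ≠ 0)
    (hc : σ c = c) : ψ y ≠ c * y := fun e =>
  hno _ (hk.isLineRoot hy)
    ((h.map_eq_iff_exists hy (div_mul_cancel₀ _ hy).symm).mpr ⟨c, hc, e⟩)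

/-- If `y` is an eigenvector of `ψ`, then so is `φ y`, with the same eigenvalue; as `φ` has no
eigenline, the two form a basis. -/
theorem IsCompatible.actsAsScalar_of_no_root (hσ : HasEigenvectors σ) (hB : B ≠ 0)
    (hφ : IsCompatible σ S B φ) (h : IsCompatible σ S B ψ) (hcomm : ∀ x, ψ (φ x) = φ (ψ x))
    (hno : ∀ r, IsLineRoot σ B r → φ r ≠ r) {r : K} (hr : IsLineRoot σ B r) (hψ : ψ r = r) :
    ActsAsScalar σ B ψ := by
  obtain ⟨y, hy, e, hk⟩ := hr.exists_vector hσ hB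
  obtain ⟨c, hc, f⟩ := (h.map_eq_iff_exists hy e).mp hψ
  have hD : moore σ y (φ y) ≠ 0 := fun h0 =>
    hφ.ne_smul_of_no_root hno y _ hk hy (map_div_of_moore_eq_zero hy h0)
      (div_mul_cancel₀ _ hy).symm
  exact h.actsAsScalar_of_basis hB hk (hφ.inKernel hk) hD hc f
    (by rw [hcomm, f, map_mul, hφ.fix c hc])

theorem IsCompatible.exists_unipotent (hσ : HasEigenvectors σ) (hB : B ≠ 0)
    (h : IsCompatible σ S B φ) {r₁ r₂ : K} (h₁ : IsLineRoot σ B r₁)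
    (h₂ : IsLineRoot σ B r₂) (hne : r₁ ≠ r₂) (hr₁ : φ r₁ = r₁)
    (huniq : ∀ r, IsLineRoot σ B r → φ r = r → r = r₁) :
    ∃ y₁ y₂ c b, InKernel σ B y₁ ∧ InKernel σ B y₂ ∧ moore σ y₁ y₂ ≠ 0 ∧ σ c = c ∧ σ b = b ∧
      b ≠ 0 ∧ φ y₁ = c * y₁ ∧ φ y₂ = c * y₂ + b * y₁ := by
  obtain ⟨y₁, hy₁, k₁, v₁⟩ := h₁.exists_vector hσ hB
  obtain ⟨y₂, hy₂, k₂, v₂⟩ := h₂.exists_vector hσ hB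
  have hD := moore_ne_zero hy₁ hy₂ k₁ k₂ hne
  obtain ⟨c, hc, f₁⟩ := (h.map_eq_iff_exists hy₁ k₁).mp hr₁
  obtain ⟨b, c', hb, hc', f₂⟩ := exists_coords hB v₁ v₂ hD (h.inKernel v₂)
  -- Distinct diagonal entries would make the triangular matrix diagonalizable, giving a second
  -- eigenline through `y₂ + e y₁`.
  have hcc : c' = c := by
    by_contra hcc
    have hs : c' + c ≠ 0 := by grind
    obtain ⟨e, he, hes⟩ : ∃ e, σ e = e ∧ e * (c' + c) = b :=
      ⟨b / (c' + c), by rw [map_div₀, map_add, hb, hc, hc'], div_mul_cancel₀ _ hs⟩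
    have hk : InKernel σ B (y₂ + e * y₁) := v₂.add (v₁.mul he)
    have hm : moore σ y₁ (y₂ + e * y₁) = moore σ y₁ y₂ := by
      simp only [moore, map_add, map_mul, he]
      grind
    have hn : y₂ + e * y₁ ≠ 0 := by
      intro h0
      rw [h0] at hm
      apply hD
      rw [← hm]
      simp [moore]
    have hroot := huniq _ (hk.isLineRoot hn)
      ((h.map_eq_iff_exists hn (div_mul_cancel₀ _ hn).symm).mpr ⟨c', hc', by
        rw [map_add, map_mul, h.fix e he, f₁, f₂]
        grind⟩)
    apply hD
    rw [← hm, moore, k₁, ← div_mul_cancel₀ (σ (y₂ + e * y₁)) hn, hroot]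
    grind
  refine ⟨y₁, y₂, c, b, v₁, v₂, hD, hc, hb, ?_, f₁, by rw [f₂, hcc, add_comm]⟩
  rintro rfl
  apply hne
  symm
  refine huniq _ h₂ ((h.map_eq_iff_exists hy₂ k₂).mpr ⟨c', hc', ?_⟩)
  rw [f₂]
  ring

/-- The off-diagonal entry of the square is `2 c b = 0`. -/
theorem IsCompatible.actsAsScalar_of_unipotent (hB : B ≠ 0) (hφ : IsCompatible σ S B φ)
    (h : IsCompatible σ S B ψ) (hsq : ∀ x, ψ x = φ (φ x)) {y₁ y₂ c b : K}
    (h₁ : InKernel σ B y₁) (h₂ : InKernel σ B y₂) (hD : moore σ y₁ y₂ ≠ 0)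
    (hc : σ c = c) (hb : σ b = b) (e₁ : φ y₁ = c * y₁) (e₂ : φ y₂ = c * y₂ + b * y₁) :
    ActsAsScalar σ B ψ := by
  refine h.actsAsScalar_of_basis hB h₁ h₂ hD (c := c ^ 2) (by rw [map_pow, hc]) ?_ ?_
  · rw [hsq, e₁, map_mul, hφ.fix c hc, e₁]
    ring
  · rw [hsq, e₂, map_add, map_mul, map_mul, hφ.fix c hc, hφ.fix b hb, e₁, e₂]
    grind

end Lines

/-! ### The concrete maps: Frobenius powers and the trace sum -/

section ArtinSum

/-- The additive map `x ↦ ∑_{i < n} x ^ (2 ^ i)` in characteristic two. -/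
def artinSum (K : Type*) [Field K] [CharP K 2] (n : ℕ) : K →+ K where
  toFun x := ∑ i ∈ Finset.range n, x ^ 2 ^ i
  map_zero' := Finset.sum_eq_zero fun i _ => zero_pow (pow_ne_zero i two_ne_zero)
  map_add' x y := by
    rw [← Finset.sum_add_distrib]
    exact Finset.sum_congr rfl fun i _ => add_pow_char_pow x y 2 i

variable {K : Type*} [Field K] [CharP K 2]

theorem artinSum_apply (n : ℕ) (x : K) :
    artinSum K n x = ∑ i ∈ Finset.range n, x ^ 2 ^ i := rfl

theorem map_artinSum (n : ℕ) (ψ : K →+* K) (x : K) :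
    ψ (artinSum K n x) = artinSum K n (ψ x) := by
  simp only [artinSum_apply, map_sum, map_pow]

theorem isArtinSchreier_artinSum (n : ℕ) :
    IsArtinSchreier (iterateFrobenius K 2 n) (artinSum K n) where
  sq x := (map_artinSum n (frobenius K 2) x).symm
  comm x := (map_artinSum n (iterateFrobenius K 2 n) x).symm
  sq_add_self x := by
    have hsq : artinSum K n x ^ 2 = artinSum K n (x ^ 2) := map_artinSum n (frobenius K 2) x
    rw [hsq, iterateFrobenius_def, artinSum_apply, artinSum_apply]
    induction n with
    | zero => simp [CharTwo.add_self_eq_zero]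
    | succ n ih =>
      have hsq' : artinSum K n x ^ 2 = artinSum K n (x ^ 2) := map_artinSum n (frobenius K 2) x
      have ih := ih hsq'
      rw [Finset.sum_range_succ, Finset.sum_range_succ, ← pow_mul, ← pow_succ']
      grind

theorem isCompatible_iterateFrobenius {n : ℕ} {B : K} {k : ℕ} (hB : B ^ 2 ^ (n * k) = B) :
    IsCompatible (iterateFrobenius K 2 n) (artinSum K n) B (iterateFrobenius K 2 (n * k)) where
  comm x := by simp only [iterateFrobenius_def, ← pow_mul, mul_comm]
  commS x := map_artinSum n _ x
  map_const := hB
  fix c hc := by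
    rw [coe_iterateFrobenius_mul]
    exact Function.IsFixedPt.iterate hc k

theorem hasEigenvectors_iterateFrobenius [IsAlgClosed K] {n : ℕ} (hn : n ≠ 0) :
    HasEigenvectors (iterateFrobenius K 2 n) := by
  intro r hr
  have h1 : 1 < 2 ^ n := Nat.one_lt_two_pow hn
  obtain ⟨y, rfl⟩ := IsAlgClosed.exists_pow_nat_eq r (n := 2 ^ n - 1) (by omega)
  refine ⟨y, ?_, ?_⟩
  · rintro rfl
    exact hr (zero_pow (by omega))
  · rw [iterateFrobenius_def, pow_sub_one_mul (by omega)]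

end ArtinSum

/-! ### Degrees and separability -/

section Polynomials

variable {F : Type*} [Field F]

theorem X_mul_mcmT (n : ℕ) : X * mcmT F n = ∑ i ∈ Finset.range n, X ^ 2 ^ i := by
  rw [mcmT, Finset.mul_sum]
  exact Finset.sum_congr rfl fun i _ => mul_pow_sub_one (pow_ne_zero i two_ne_zero) X

theorem natDegree_X_mul_mcmT (n : ℕ) : (X * mcmT F (n + 1)).natDegree = 2 ^ n := by
  rw [X_mul_mcmT, Finset.sum_range_succ, natDegree_add_eq_right_of_natDegree_lt, natDegree_X_pow]
  have hpos : 0 < 2 ^ n := by positivity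
  rw [natDegree_X_pow]
  refine lt_of_le_of_lt (natDegree_sum_le_of_forall_le _ _ (n := 2 ^ n - 1) fun i hi => ?_)
    (by omega)
  rw [natDegree_X_pow]
  have := Nat.pow_lt_pow_right one_lt_two (Finset.mem_range.mp hi)
  omega

theorem mcmT_ne_zero (n : ℕ) : mcmT F (n + 1) ≠ 0 := by
  intro h
  have := natDegree_X_mul_mcmT (F := F) n
  rw [h, mul_zero, natDegree_zero] at this
  have hpos : 0 < 2 ^ n := by positivity
  omega

theorem natDegree_mcmC (n : ℕ) : (mcmC F (n + 1)).natDegree = 2 ^ n * (2 ^ (n + 1) - 1) := by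
  have h1 := natDegree_X_mul_mcmT (F := F) n
  rw [natDegree_X_mul (mcmT_ne_zero n)] at h1
  rw [mcmC, natDegree_X_mul (pow_ne_zero _ (mcmT_ne_zero n)), natDegree_pow]
  obtain ⟨t, ht⟩ : ∃ t, t = (mcmT F (n + 1)).natDegree := ⟨_, rfl⟩
  rw [← ht] at h1 ⊢
  rw [pow_succ, ← h1]
  have : (t + 1) * 2 - 1 = 2 * t + 1 := by omega
  rw [this]
  ring

theorem separable_X_pow_add_X_add_C {q : ℕ} (hq : (q : F) = 0) {b : F} (hb : b ≠ 0) :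
    (X ^ (q + 1) + X + C b).Separable := by
  have hd : derivative (X ^ (q + 1) + X + C b) = X ^ q + 1 := by
    simp [hq]
  rw [separable_def, hd]
  -- Bézout relation: the polynomial minus `X` times its derivative is the constant `b`.
  refine ⟨C b⁻¹, -(C b⁻¹ * X), ?_⟩
  have : C b⁻¹ * C b = (1 : F[X]) := by rw [← C_mul, inv_mul_cancel₀ hb, C_1]
  linear_combination this

variable [CharP F 2]

theorem derivative_X_mul_mcmT {n : ℕ} : derivative (X * mcmT F (n + 1)) = 1 := by
  rw [X_mul_mcmT, Finset.sum_range_succ', derivative_add, derivative_sum, Finset.sum_eq_zero]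
  · simp
  · intro i _
    rw [derivative_X_pow, pow_succ]
    simp [CharTwo.two_eq_zero]

/-- Write `C = (X T) T^q`; since `(X T)' = 1`, `C' = T^q`, and subtracting `X T · C'` from `C + a`
leaves `a`. -/
theorem separable_mcmC_add_C {n : ℕ} {a : F} (ha : a ≠ 0) :
    (mcmC F (n + 1) + C a).Separable := by
  have hd : derivative (mcmC F (n + 1) + C a) = mcmT F (n + 1) ^ 2 ^ (n + 1) := by
    have : mcmC F (n + 1) = X * mcmT F (n + 1) * mcmT F (n + 1) ^ 2 ^ (n + 1) := by
      rw [mcmC, pow_succ]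
      ring
    rw [this, derivative_add, derivative_C, add_zero, derivative_mul, derivative_X_mul_mcmT,
      derivative_pow]
    simp [CharTwo.two_eq_zero]
  rw [separable_def, hd]
  refine ⟨C a⁻¹, -(C a⁻¹ * X * mcmT F (n + 1)), ?_⟩
  have : C a⁻¹ * C a = (1 : F[X]) := by rw [← C_mul, inv_mul_cancel₀ ha, C_1]
  rw [← this, mcmC]
  ring

theorem separable_X_mul_mcmT_sub_one (n : ℕ) : (X * mcmT F (n + 1) - 1).Separable := by
  rw [separable_def, derivative_sub, derivative_X_mul_mcmT, derivative_one, sub_zero]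
  exact isCoprime_one_right

theorem ncard_artinSum_eq_one [IsAlgClosed F] (n : ℕ) :
    {x : F | artinSum F (n + 1) x = 1}.ncard = 2 ^ n := by
  have h := ncard_aeval_eq_zero (K := F) (separable_X_mul_mcmT_sub_one (F := F) n)
  rw [← C_1, natDegree_sub_C, natDegree_X_mul_mcmT] at h
  rw [← h]
  congr 1
  ext x
  simp [X_mul_mcmT, artinSum_apply, sub_eq_zero]

end Polynomials

/-! ### Polynomial roots in terms of `σ` and `S` -/

section PolynomialRoots

variable {F K : Type*} [Field F] [Field K] [Algebra F K] [CharP K 2]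

theorem natDegree_X_pow_add_X_add_C {q : ℕ} (hq : q ≠ 0) (b : F) :
    (X ^ (q + 1) + X + C b).natDegree = q + 1 := by
  rw [natDegree_add_C, natDegree_add_eq_left_of_natDegree_lt, natDegree_X_pow]
  rw [natDegree_X_pow, natDegree_X]
  omega

theorem aeval_eq_zero_iff_isLineRoot (n : ℕ) (b : F) (x : K) :
    aeval x (X ^ (2 ^ n + 1) + X + C b : F[X]) = 0 ↔
      IsLineRoot (iterateFrobenius K 2 n) (algebraMap F K b) x := by
  simp [IsLineRoot, iterateFrobenius_def, pow_succ]

theorem aeval_eq_zero_iff_isMCMRoot (n : ℕ) {a : F} (ha : a ≠ 0) (x : K) :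
    aeval x (mcmC F n + C a) = 0 ↔
      IsMCMRoot (iterateFrobenius K 2 n) (artinSum K n) (algebraMap F K (1 / a)) x := by
  have hS : artinSum K n x = x * aeval x (mcmT F n) := by
    have h := congrArg (aeval x) (X_mul_mcmT (F := F) n)
    rw [map_mul, aeval_X] at h
    rw [h, artinSum_apply]
    simp
  have ha' : algebraMap F K a ≠ 0 := (_root_.map_ne_zero _).mpr ha
  have hp : (2 ^ n) ≠ 0 := pow_ne_zero _ two_ne_zero
  rw [IsMCMRoot, hS, iterateFrobenius_def, iterateFrobenius_def, mcmC, map_add, map_mul, map_pow,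
    aeval_X, aeval_C, map_div₀, map_one]
  set t := aeval x (mcmT F n)
  set b := algebraMap F K a
  -- Multiplying `x T^(q+1) = a` by `x^q` expresses it through `S x = x T`.
  have key : (1 / b) * (x * t * (x * t) ^ 2 ^ n) = x ^ 2 ^ n * ((1 / b) * (x * t ^ (2 ^ n + 1))) := by
    ring
  rw [key]
  constructor
  · intro h
    have hx : x ≠ 0 := by
      rintro rfl
      rw [zero_mul, zero_add] at h
      exact ha' h
    refine ⟨hx, ?_⟩
    have : x * t ^ (2 ^ n + 1) = b := by grind
    rw [this, one_div, inv_mul_cancel₀ ha', mul_one]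
  · rintro ⟨hx, h⟩
    have h1 := mul_left_cancel₀ (pow_ne_zero _ hx) ((mul_one _).trans h)
    field_simp at h1
    rw [h1]
    grind

end PolynomialRoots

/-! ### The four cases -/

theorem charP_two_of_card_eq_two_pow {F : Type*} [Field F] [Finite F] {k : ℕ}
    (h : Nat.card F = 2 ^ k) : CharP F 2 := by
  have := Fintype.ofFinite F
  have h0 : (Fintype.card F : F) = 0 := FiniteField.cast_card_eq_zero F
  rw [← Nat.card_eq_fintype_card, h, Nat.cast_pow] at h0
  exact CharTwo.of_one_ne_zero_of_two_eq_zero one_ne_zero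
    (by exact_mod_cast eq_zero_of_pow_eq_zero h0)

set_option maxHeartbeats 1000000 in
theorem corollary6p3 (n m q : ℕ) (hq : q = 2 ^ n) (hq2 : 2 < q)
    (F : Type*) [Field F] [Finite F] (hF : Nat.card F = q ^ m)
    (a : F) (ha : a ≠ 0) (f g : F[X])
    (hf : f = X ^ (q + 1) + X + C (1 / a)) (hg : g = mcmC F n + C a) :
    (3 ≤ (f.rootSet F).ncard → f.Splits ∧ g.Splits) ∧
    ((f.rootSet F).ncard = 2 → ∃ δ : ℕ, δ ∣ q - 1 ∧
      HasFactorType f ({1, 1} + Multiset.replicate ((q - 1) / δ) δ) ∧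
      HasFactorType g (Multiset.replicate (q / 2 * ((q - 1) / δ)) δ)) ∧
    ((f.rootSet F).ncard = 1 →
      HasFactorType f ({1} + Multiset.replicate (q / 2) 2) ∧
      HasFactorType g
        (Multiset.replicate (q / 2) 1 + Multiset.replicate ((q ^ 2 - 2 * q) / 4) 2)) ∧
    ((f.rootSet F).ncard = 0 → ∃ δ : ℕ, δ ∣ q + 1 ∧
      HasFactorType f (Multiset.replicate ((q + 1) / δ) δ) ∧
      HasFactorType g ({1} + Multiset.replicate ((q / 2 - 1) * ((q + 1) / δ)) δ)) := by
  have hF' : Nat.card F = 2 ^ (n * m) := by rw [hF, hq, pow_mul]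
  have : CharP F 2 := charP_two_of_card_eq_two_pow hF'
  obtain ⟨k, rfl⟩ : ∃ k, n = k + 1 := by
    refine Nat.exists_eq_succ_of_ne_zero ?_
    rintro rfl
    rw [hq, pow_zero] at hq2
    omega
  obtain ⟨h, hh⟩ : ∃ h, h = 2 ^ k := ⟨_, rfl⟩
  have hqh : q = 2 * h := by rw [hq, hh, pow_succ']
  let K := AlgebraicClosure F
  have : CharP K 2 := charP_of_injective_algebraMap (algebraMap F K).injective 2
  set N := Nat.card F with hN
  let σ : K →+* K := iterateFrobenius K 2 (k + 1)
  let S : K →+ K := artinSum K (k + 1)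
  let B : K := algebraMap F K (1 / a)
  -- `φ j` is the `j`-th power of the Frobenius of `F`; its exponent is a multiple of `k + 1`, which
  -- makes it an iterate of `σ` and hence F_q-linear.
  let φ : ℕ → K →+* K := fun j => iterateFrobenius K 2 ((k + 1) * (m * j))
  have hφ : ∀ j x, φ j x = x ^ N ^ j := fun j x => by
    rw [hF', ← pow_mul, mul_assoc]
    rfl
  have hφ₁ : ∀ x, φ 1 x = x ^ N := fun x => by rw [hφ, pow_one]
  have hB : B ≠ 0 := (_root_.map_ne_zero _).mpr (one_div_ne_zero ha)
  have hS : IsArtinSchreier σ S := isArtinSchreier_artinSum (k + 1)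
  have hσ : HasEigenvectors σ := hasEigenvectors_iterateFrobenius k.succ_ne_zero
  have hcompat : ∀ j, IsCompatible σ S B (φ j) := fun j => by
    refine isCompatible_iterateFrobenius ?_
    have := Fintype.ofFinite F
    change φ j B = B
    rw [hφ, ← map_pow, hN, Nat.card_eq_fintype_card, FiniteField.pow_card_pow]
  have hsepf : f.Separable := by
    rw [hf]
    refine separable_X_pow_add_X_add_C ?_ (one_div_ne_zero ha)
    rw [hqh, Nat.cast_mul, Nat.cast_two, CharTwo.two_eq_zero, zero_mul]
  have hsepg : g.Separable := by
    rw [hg]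
    exact separable_mcmC_add_C ha
  have hdegf : f.natDegree = q + 1 := by
    rw [hf]
    exact natDegree_X_pow_add_X_add_C (by omega) _
  have hdegg : g.natDegree = h * (q - 1) := by
    rw [hg, natDegree_add_C, natDegree_mcmC, hh, hq]
  have hrf : ∀ x : K, aeval x f = 0 ↔ IsLineRoot σ B x := fun x => by
    rw [hf, hq]
    exact aeval_eq_zero_iff_isLineRoot _ _ _
  have hrg : ∀ x : K, aeval x g = 0 ↔ IsMCMRoot σ S B x := fun x => by
    rw [hg]
    exact aeval_eq_zero_iff_isMCMRoot _ ha _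
  have hcf : (f.rootSet F).ncard = {x : K | IsLineRoot σ B x ∧ φ 1 x = x}.ncard := by
    rw [ncard_rootSet_eq (K := K) hsepf.ne_zero]
    simp only [hrf, hφ₁]
    rfl
  have hcg : (g.rootSet F).ncard = {x : K | IsMCMRoot σ S B x ∧ φ 1 x = x}.ncard := by
    rw [ncard_rootSet_eq (K := K) hsepg.ne_zero]
    simp only [hrg, hφ₁]
    rfl
  have hall : {x : K | IsLineRoot σ B x}.ncard = q + 1 := by
    rw [← hdegf, ← ncard_aeval_eq_zero (K := K) hsepf]
    simp only [hrf]
  have hfin : {x : K | IsLineRoot σ B x}.Finite := Set.finite_of_ncard_ne_zero (by omega)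
  have hfinφ : {x : K | IsLineRoot σ B x ∧ φ 1 x = x}.Finite := hfin.subset fun x hx => hx.1
  obtain ⟨y₁, y₂, v₁, v₂, hD⟩ : ∃ y₁ y₂, InKernel σ B y₁ ∧ InKernel σ B y₂ ∧
      moore σ y₁ y₂ ≠ 0 := by
    obtain ⟨r₁, r₂, h₁, h₂, hne⟩ := (Set.one_lt_ncard_iff hfin).mp (by omega)
    obtain ⟨y₁, hy₁, k₁, v₁⟩ := IsLineRoot.exists_vector hσ hB h₁
    obtain ⟨y₂, hy₂, k₂, v₂⟩ := IsLineRoot.exists_vector hσ hB h₂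
    exact ⟨y₁, y₂, v₁, v₂, moore_ne_zero hy₁ hy₂ k₁ k₂ hne⟩
  have hscalar : ∀ j, ActsAsScalar σ B (φ j) → ∀ x, IsMCMRoot σ S B x → φ j x = x :=
    fun j hj x hx => hx.map_eq_of_actsAsScalar hS hB (hcompat j) hj v₁ v₂ hD
  /- The common part of the cases where a nontrivial orbit has length `δ`. -/
  have horbit : ∀ r, IsLineRoot σ B r → φ 1 r ≠ r →
      (∀ j, φ j r = r → ActsAsScalar σ B (φ j)) → ∃ δ, δ ≠ 1 ∧ δ ≠ 0 ∧
        ∀ j, ActsAsScalar σ B (φ j) ↔ δ ∣ j := by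
    intro r hr hne hj
    have hint : IsIntegral F r := Algebra.IsIntegral.isIntegral r
    have hδ : ∀ j, (minpoly F r).natDegree ∣ j ↔ φ j r = r := fun j => by
      rw [hφ, natDegree_minpoly_dvd_iff hint]
    refine ⟨(minpoly F r).natDegree, fun h1 => hne ?_, (minpoly.natDegree_pos hint).ne',
      fun j => ⟨fun h1 => (hδ j).mpr ((hcompat j).map_eq_of_actsAsScalar hσ hB h1 hr),
        fun h1 => hj j ((hδ j).mp h1)⟩⟩
    rw [← hδ, h1]
  -- If a root not fixed by `φ 1` can be fixed by `φ j` only when `φ j` is scalar, its orbit has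
  -- length exactly `δ`.
  have hfactor : ∀ δ, δ ≠ 1 → (∀ j, ActsAsScalar σ B (φ j) ↔ δ ∣ j) →
      (∀ x, IsLineRoot σ B x → φ 1 x = x ∨ ∀ j, φ j x = x → ActsAsScalar σ B (φ j)) →
      (∀ x, IsMCMRoot σ S B x → φ 1 x = x ∨ ∀ j, φ j x = x → ActsAsScalar σ B (φ j)) →
      (∃ e, HasFactorType f
          (Multiset.replicate (f.rootSet F).ncard 1 + Multiset.replicate e δ) ∧
        (f.rootSet F).ncard + e * δ = q + 1) ∧
      ∃ e, HasFactorType g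
          (Multiset.replicate (g.rootSet F).ncard 1 + Multiset.replicate e δ) ∧
        (g.rootSet F).ncard + e * δ = h * (q - 1) := by
    intro δ hδ1 hδ hl hm
    rw [← hdegf, ← hdegg]
    constructor
    · refine exists_hasFactorType_of_orbits (K := K) hsepf hδ1 fun x hx => ?_
      rw [hrf] at hx
      rw [← hφ₁]
      refine (hl x hx).imp_right fun h1 j => ?_
      rw [← hφ, ← hδ]
      exact ⟨h1 j, fun h2 => (hcompat j).map_eq_of_actsAsScalar hσ hB h2 hx⟩
    · refine exists_hasFactorType_of_orbits (K := K) hsepg hδ1 fun x hx => ?_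
      rw [hrg] at hx
      rw [← hφ₁]
      refine (hm x hx).imp_right fun h1 j => ?_
      rw [← hφ, ← hδ]
      exact ⟨h1 j, fun h2 => hscalar j h2 x hx⟩
  have hcomm : ∀ i j x, φ i (φ j x) = φ j (φ i x) := fun i j x => by
    simp only [hφ, ← pow_mul, mul_comm]
  have hφmul : ∀ j x, φ 1 x = x → φ j x = x := fun j x hx => by
    have := (natDegree_minpoly_dvd_iff (Algebra.IsIntegral.isIntegral (R := F) x) 1).mpr
      (by rw [← hN, ← hφ, hx])
    rw [hφ]
    exact (natDegree_minpoly_dvd_iff (Algebra.IsIntegral.isIntegral (R := F) x) j).mp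
      (this.trans (one_dvd j))
  refine ⟨fun hc => ?_, fun hc => ?_, fun hc => ?_, fun hc => ?_⟩
  · rw [hcf] at hc
    obtain ⟨r₁, r₂, r₃, h₁, h₂, h₃, h₁₂, h₁₃, h₂₃⟩ := (Set.two_lt_ncard_iff hfinφ).mp hc
    have hsc := (hcompat 1).actsAsScalar_of_three_roots hσ hB h₁.1 h₂.1 h₃.1 h₁₂ h₁₃ h₂₃
      h₁.2 h₂.2 h₃.2
    refine ⟨splits_of_forall_pow_card_eq (K := K) hsepf fun x hx => ?_,
      splits_of_forall_pow_card_eq (K := K) hsepg fun x hx => ?_⟩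
    · rw [← hN, ← hφ₁]
      exact (hcompat 1).map_eq_of_actsAsScalar hσ hB hsc ((hrf x).mp hx)
    · rw [← hN, ← hφ₁]
      exact hscalar 1 hsc x ((hrg x).mp hx)
  · have hc' := hc
    rw [hcf] at hc'
    obtain ⟨r₁, r₂, h₁₂, hset⟩ := Set.ncard_eq_two.mp hc'
    have h₁ : IsLineRoot σ B r₁ ∧ φ 1 r₁ = r₁ := by
      have : r₁ ∈ {x : K | IsLineRoot σ B x ∧ φ 1 x = x} := by rw [hset]; simp
      exact this
    have h₂ : IsLineRoot σ B r₂ ∧ φ 1 r₂ = r₂ := by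
      have : r₂ ∈ {x : K | IsLineRoot σ B x ∧ φ 1 x = x} := by rw [hset]; simp
      exact this
    -- Together with `r₁` and `r₂`, a further root fixed by `φ j` is a third eigenline.
    have hthird : ∀ r, IsLineRoot σ B r → φ 1 r ≠ r → ∀ j, φ j r = r →
        ActsAsScalar σ B (φ j) := fun r hr hne j hj =>
      (hcompat j).actsAsScalar_of_three_roots hσ hB h₁.1 h₂.1 hr h₁₂
        (fun e => hne (e ▸ h₁.2)) (fun e => hne (e ▸ h₂.2)) (hφmul j _ h₁.2) (hφmul j _ h₂.2) hj
    obtain ⟨r, hr, hrn⟩ := Set.exists_mem_notMem_of_ncard_lt_ncard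
      (s := {x : K | IsLineRoot σ B x ∧ φ 1 x = x}) (t := {x : K | IsLineRoot σ B x})
      (by omega) hfinφ
    have hrn : φ 1 r ≠ r := fun e => hrn ⟨hr, e⟩
    obtain ⟨δ, hδ1, hδ0, hδ⟩ := horbit r hr hrn (hthird r hr hrn)
    have hmcm : ∀ x, IsMCMRoot σ S B x → ∀ j, φ j x = x → ActsAsScalar σ B (φ j) := by
      intro x hx j hj
      obtain ⟨z₁, hz₁, k₁, w₁⟩ := h₁.1.exists_vector hσ hB
      obtain ⟨z₂, hz₂, k₂, w₂⟩ := h₂.1.exists_vector hσ hB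
      obtain ⟨c₁, hc₁, f₁⟩ := ((hcompat j).map_eq_iff_exists hz₁ k₁).mp (hφmul j _ h₁.2)
      obtain ⟨c₂, hc₂, f₂⟩ := ((hcompat j).map_eq_iff_exists hz₂ k₂).mp (hφmul j _ h₂.2)
      have hD' := moore_ne_zero hz₁ hz₂ k₁ k₂ h₁₂
      have := hx.eq_of_two_eigenvectors hS hB (hcompat j) w₁ w₂ hD' hc₁ hc₂ f₁ f₂ hj
      exact (hcompat j).actsAsScalar_of_basis hB w₁ w₂ hD' hc₁ f₁ (this ▸ f₂)
    obtain ⟨⟨e, he, hed⟩, ⟨e', he', hed'⟩⟩ := hfactor δ hδ1 hδ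
      (fun x hx => or_iff_not_imp_left.mpr fun h1 => hthird x hx h1)
      (fun x hx => Or.inr (hmcm x hx))
    have hg0 : (g.rootSet F).ncard = 0 := by
      rw [hcg]
      convert Set.ncard_empty K
      refine Set.eq_empty_iff_forall_notMem.mpr fun x hx => ?_
      exact hδ1 (Nat.dvd_one.mp ((hδ 1).mp (hmcm x hx.1 1 hx.2)))
    rw [hg0, zero_add] at hed'
    rw [hc] at hed he
    have hed : e * δ = q - 1 := by omega
    have hdiv : (q - 1) / δ = e := by
      rw [← hed, Nat.mul_div_cancel _ (Nat.pos_of_ne_zero hδ0)]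
    refine ⟨δ, ⟨e, by rw [← hed, mul_comm]⟩, ?_, ?_⟩
    · rw [hdiv]
      exact he
    · rw [hg0, Multiset.replicate_zero, zero_add] at he'
      have : q / 2 * e = e' := by
        refine Nat.eq_of_mul_eq_mul_right (Nat.pos_of_ne_zero hδ0) ?_
        rw [hed', mul_assoc, hed]
        congr 1
        omega
      rw [hdiv, this]
      exact he'
  · have hc' := hc
    rw [hcf] at hc'
    obtain ⟨r₁, hset⟩ := Set.ncard_eq_one.mp hc'
    have h₁ : IsLineRoot σ B r₁ ∧ φ 1 r₁ = r₁ := by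
      have : r₁ ∈ {x : K | IsLineRoot σ B x ∧ φ 1 x = x} := by rw [hset]; simp
      exact this
    have huniq : ∀ r, IsLineRoot σ B r → φ 1 r = r → r = r₁ := by
      intro r hr e
      have : r ∈ {x : K | IsLineRoot σ B x ∧ φ 1 x = x} := ⟨hr, e⟩
      rwa [hset] at this
    obtain ⟨r, hr, hrn⟩ := Set.exists_mem_notMem_of_ncard_lt_ncard
      (s := {x : K | IsLineRoot σ B x ∧ φ 1 x = x}) (t := {x : K | IsLineRoot σ B x})
      (by omega) hfinφ
    have hne : r₁ ≠ r := fun e => hrn (e ▸ h₁)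
    obtain ⟨z₁, z₂, c, b, w₁, w₂, hD', hc₁, hb, hb0, f₁, f₂⟩ :=
      (hcompat 1).exists_unipotent hσ hB h₁.1 hr hne h₁.2 huniq
    have hsq : ∀ x, φ 2 x = φ 1 (φ 1 x) := fun x => by
      rw [hφ, hφ, hφ, ← pow_mul]
      ring_nf
    have hsc := (hcompat 1).actsAsScalar_of_unipotent hB (hcompat 2) hsq w₁ w₂ hD' hc₁ hb f₁ f₂
    have hdvd : ∀ x : K, φ 2 x = x → x ^ N = x ∨ ∀ j, x ^ N ^ j = x ↔ 2 ∣ j := by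
      intro x hx
      have hint : IsIntegral F x := Algebra.IsIntegral.isIntegral x
      rw [hφ, ← natDegree_minpoly_dvd_iff hint, Nat.dvd_prime Nat.prime_two] at hx
      refine hx.imp (fun h1 => ?_) fun h1 j => ?_
      · rw [← pow_one N, ← natDegree_minpoly_dvd_iff hint, h1]
      · rw [← natDegree_minpoly_dvd_iff hint, h1]
    obtain ⟨e, he, hed⟩ := exists_hasFactorType_of_orbits (K := K) hsepf (δ := 2) (by decide)
      fun x hx => hdvd x ((hcompat 2).map_eq_of_actsAsScalar hσ hB hsc ((hrf x).mp hx))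
    obtain ⟨e', he', hed'⟩ := exists_hasFactorType_of_orbits (K := K) hsepg (δ := 2) (by decide)
      fun x hx => hdvd x (hscalar 2 hsc x ((hrg x).mp hx))
    have hg0 : (g.rootSet F).ncard = q / 2 := by
      rw [hcg, ncard_isMCMRoot_of_unipotent hS hB (hcompat 1) w₁ w₂ hD' hc₁ hb hb0 f₁ f₂]
      rw [hqh, Nat.mul_div_cancel_left _ two_pos, hh]
      exact ncard_artinSum_eq_one k
    rw [hc] at he hed
    rw [hg0] at he' hed'
    have h1 : q / 2 = e := by omega
    have h2 : (q ^ 2 - 2 * q) / 4 = e' := by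
      rw [hdegg, hqh, Nat.mul_div_cancel_left _ two_pos] at hed'
      rw [hqh]
      obtain ⟨u, rfl⟩ : ∃ u, h = u + 1 := Nat.exists_eq_succ_of_ne_zero (by omega)
      have h3 : 2 * (u + 1) - 1 = 2 * u + 1 := by omega
      rw [h3] at hed'
      have h4 : (2 * (u + 1)) ^ 2 - 2 * (2 * (u + 1)) = 4 * (u * (u + 1)) := by
        rw [Nat.sub_eq_iff_eq_add (by nlinarith)]
        ring
      rw [h4, Nat.mul_div_cancel_left _ (by norm_num)]
      nlinarith
    rw [h2]
    refine ⟨?_, he'⟩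
    rw [h1]
    exact he
  · have hc' := hc
    rw [hcf, Set.ncard_eq_zero hfinφ] at hc'
    have hno : ∀ r, IsLineRoot σ B r → φ 1 r ≠ r := fun r hr e =>
      Set.eq_empty_iff_forall_notMem.mp hc' r ⟨hr, e⟩
    have hline : ∀ r, IsLineRoot σ B r → ∀ j, φ j r = r → ActsAsScalar σ B (φ j) :=
      fun r hr j hj => (hcompat 1).actsAsScalar_of_no_root hσ hB (hcompat j)
        (hcomm j 1) hno hr hj
    obtain ⟨r, hr⟩ := Set.nonempty_of_ncard_ne_zero (s := {x : K | IsLineRoot σ B x}) (by omega)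
    obtain ⟨δ, hδ1, hδ0, hδ⟩ := horbit r hr (hno r hr) (hline r hr)
    have hy₁ : y₁ ≠ 0 := by
      rintro rfl
      simp [moore] at hD
    obtain ⟨x₀, hx₀, hx₀u⟩ := existsUnique_isMCMRoot hS hB (hcompat 1)
      ((hcompat 1).ne_smul_of_no_root hno) v₁ hy₁
    obtain ⟨⟨e, he, hed⟩, ⟨e', he', hed'⟩⟩ := hfactor δ hδ1 hδ
      (fun x hx => Or.inr (hline x hx)) (fun x hx => by
        refine or_iff_not_imp_left.mpr fun hn j hj => ?_
        by_contra hsc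
        -- A nonscalar `φ j` has no eigenline either, so its only fixed root is the `x₀` already
        -- fixed by `φ 1`.
        have hu := existsUnique_isMCMRoot hS hB (hcompat j)
          ((hcompat j).ne_smul_of_no_root fun r hr h1 => hsc (hline r hr j h1)) v₁ hy₁
        have := hu.unique ⟨hx, hj⟩ ⟨hx₀.1, hφmul j _ hx₀.2⟩
        exact hn (this ▸ hx₀.2))
    have hg0 : (g.rootSet F).ncard = 1 := by
      rw [hcg, Set.ncard_eq_one]
      exact ⟨x₀, Set.ext fun x => ⟨fun hx => hx₀u x hx, fun hx => by
        rw [Set.mem_singleton_iff.mp hx]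
        exact hx₀⟩⟩
    rw [hg0] at he' hed'
    rw [hc, zero_add] at hed
    rw [hc, Multiset.replicate_zero, zero_add] at he
    have hdiv : (q + 1) / δ = e := by
      rw [← hed, Nat.mul_div_cancel _ (Nat.pos_of_ne_zero hδ0)]
    refine ⟨δ, ⟨e, by rw [← hed, mul_comm]⟩, ?_, ?_⟩
    · rw [hdiv]
      exact he
    · have : (q / 2 - 1) * e = e' := by
        refine Nat.eq_of_mul_eq_mul_right (Nat.pos_of_ne_zero hδ0) ?_
        rw [mul_assoc, hed]
        obtain ⟨u, rfl⟩ : ∃ u, h = u + 1 := Nat.exists_eq_succ_of_ne_zero (by omega)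
        have h3 : q - 1 = 2 * u + 1 := by omega
        have h4 : q / 2 - 1 = u := by omega
        rw [h3] at hed'
        rw [h4, hqh]
        nlinarith
      rw [hdiv, this]
      exact he'
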